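/- Let $X$ be a finite set with at least two elements and let $R : X^2 \to X^2$ be a bijection, $R(x,y)=(\alpha_x(y),\beta_y(x))$. Call $R$ a YBE solution if $R_{12}R_{23}R_{12}=R_{23}R_{12}R_{23}$ on $X^3$ (where $R_{ij}$ acts as $R$ on the $i$th and $j$th coordinates and fixes the other one), and call $R$ non-degenerate if all the maps $\alpha_x$ and $\beta_y$ are bijections of $X$. For $k \ge 2$ let $\mathbb{F}_R^+$ be the monoid with generators $e^i_s$ ($1\le i\le k$, $s\in X$) and relations $e^i_s e^j_t=e^j_{t'}e^i_{s'}$ for $1\le i<j\le k$ and $R(s,t)=(t',s')$, with the degree homomorphism $d:\mathbb{F}_R^+\to\mathbb{N}^k$ sending $e^i_s$ to the $i$th standard basis vector. When $R$ is a YBE solution, $(\mathbb{F}_R^+,d)$ is a single-vertex $k$-graph, i.e. $\mathbb{F}_R^+$ is countable and every $\lambda$ with $d(\lambda)=m+n$ factors uniquely as $\lambda=\mu\nu$ with $d(\mu)=m$ and $d(\nu)=n$; it is called the $k$-graph associated to $R$. An infinite path of a single-vertex $k$-graph $(\Lambda,d)$ is a family of elements $x(m,n)\in\Lambda$, for $m\le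 n$ in $\mathbb{N}^k$, with $d(x(m,n))=n-m$, $x(m,m)=1$ and $x(m,n)x(n,q)=x(m,q)$. A period of $x$ is a $p\in\mathbb{Z}^k$ with $x(m+p,n+p)=x(m,n)$ for all $m\le n$ in $\mathbb{N}^k$ with $m+p\ge 0$. The $k$-graph is aperiodic if it has an infinite path $x$ such that no shift $(m,n)\mapsto x(m+a,n+a)$, $a\in\mathbb{N}^k$, has a non-zero period. A YBE solution $R$ is aperiodic if its associated $k$-graph is aperiodic for all $k\ge2$. Then every non-degenerate YBE solution on a finite set with at least two elements is aperiodic. The converse fails: for some $N\ge 2$ there is an aperiodic YBE solution on $\{1,\dots,N\}$ which is not non-degenerate. -/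

import Mathlib

/-! ### Set-theoretical solutions of the Yang-Baxter equation -/

namespace YBE

/-- The leg map `R₁₂` on `X³`. -/
def leg12 {X : Type*} (R : X × X → X × X) : X × X × X → X × X × X :=
  fun t => ((R (t.1, t.2.1)).1, (R (t.1, t.2.1)).2, t.2.2)

/-- The leg map `R₂₃` on `X³`. -/
def leg23 {X : Type*} (R : X × X → X × X) : X × X × X → X × X × X :=
  fun t => (t.1, R (t.2.1, t.2.2))

/-- A bijection `R` of `X²` is a (set-theoretical) YBE solution if
`R₁₂ R₂₃ R₁₂ = R₂₃ R₁₂ R₂₃` on `X³`. -/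
def IsSolution {X : Type*} (R : Equiv.Perm (X × X)) : Prop :=
  leg12 R ∘ leg23 R ∘ leg12 R = leg23 R ∘ leg12 R ∘ leg23 R

/-- Writing `R (x, y) = (u, v)`: the map `x ↦ v` is bijective for every fixed `y`, and the map
`y ↦ u` is bijective for every fixed `x`. -/
def IsNondegenerate {X : Type*} (R : Equiv.Perm (X × X)) : Prop :=
  (∀ y : X, Function.Bijective fun x : X => (R (x, y)).2) ∧
  (∀ x : X, Function.Bijective fun y : X => (R (x, y)).1)

/-- The commutation relations `eⁱ_s eʲ_t = eʲ_t' eⁱ_s'` for colours `i < j` and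
`R (s, t) = (t', s')`. The generator `eⁱ_s` is the pair `(i, s)`. -/
inductive CommRel {X : Type*} (R : Equiv.Perm (X × X)) (k : ℕ) :
    FreeMonoid (Fin k × X) → FreeMonoid (Fin k × X) → Prop
  | swap (i j : Fin k) (hij : i < j) (s t t' s' : X) (h : R (s, t) = (t', s')) :
      CommRel R k (FreeMonoid.of (i, s) * FreeMonoid.of (j, t))
        (FreeMonoid.of (j, t') * FreeMonoid.of (i, s'))

/-- The unital semigroup `𝔽_R⁺` on `k` colours. -/
abbrev AssocMonoid {X : Type*} (R : Equiv.Perm (X × X)) (k : ℕ) : Type _ :=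
  PresentedMonoid (CommRel R k)

/-- The degree map `d : 𝔽_R⁺ → ℕᵏ`, which sends `eⁱ_s` to the `i`-th standard basis vector. -/
def assocDegree {X : Type*} (R : Equiv.Perm (X × X)) (k : ℕ) :
    AssocMonoid R k →* Multiplicative (Fin k → ℕ) :=
  PresentedMonoid.lift (fun e : Fin k × X => Multiplicative.ofAdd (Pi.single e.1 1)) (by
    rintro _ _ ⟨i, j, _, s, t, t', s', _⟩
    simp [mul_comm])

end YBE

/-! ### Single-vertex `k`-graphs and their infinite paths

A small category with one object is a monoid; a single-vertex `k`-graph is given by a monoid `Λ`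
with a degree homomorphism `d : Λ → ℕᵏ`. -/

namespace KGraph

/-- `(Λ, d)` is a (single-vertex) `k`-graph: `Λ` is countable and `d` has the factorization
property. -/
def IsSingleVertexKGraph {k : ℕ} {Λ : Type*} [Monoid Λ]
    (d : Λ →* Multiplicative (Fin k → ℕ)) : Prop :=
  Countable Λ ∧ ∀ (l : Λ) (m n : Fin k → ℕ), (d l).toAdd = m + n →
    ∃! p : Λ × Λ, (d p.1).toAdd = m ∧ (d p.2).toAdd = n ∧ l = p.1 * p.2

/-- An infinite path of `(Λ, d)`: a degree-preserving functor `x` to `Λ` from the `k`-graph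
`Ω_k = {(m, n) ∈ ℕᵏ × ℕᵏ : m ≤ n}`, in which `(m, n)` has degree `n - m` and
`(m, n)(n, q) = (m, q)`. -/
structure InfinitePath {k : ℕ} {Λ : Type*} [Monoid Λ]
    (d : Λ →* Multiplicative (Fin k → ℕ)) where
  seg : ∀ m n : Fin k → ℕ, m ≤ n → Λ
  degree_seg : ∀ (m n : Fin k → ℕ) (h : m ≤ n), m + (d (seg m n h)).toAdd = n
  seg_self : ∀ m : Fin k → ℕ, seg m m le_rfl = 1
  seg_mul_seg : ∀ (m n q : Fin k → ℕ) (h : m ≤ n) (h' : n ≤ q),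
    seg m n h * seg n q h' = seg m q (h.trans h')

/-- The shifted path `σᵃ x`, `(σᵃ x)(m, n) = x(m + a, n + a)`. -/
def InfinitePath.shift {k : ℕ} {Λ : Type*} [Monoid Λ] {d : Λ →* Multiplicative (Fin k → ℕ)}
    (x : InfinitePath d) (a : Fin k → ℕ) : InfinitePath d where
  seg m n h := x.seg (m + a) (n + a) (by gcongr)
  degree_seg m n h := by
    have := x.degree_seg (m + a) (n + a) (by gcongr)
    rw [add_right_comm] at this
    exact add_right_cancel this
  seg_self m := x.seg_self (m + a)
  seg_mul_seg m n q h h' := x.seg_mul_seg (m + a) (n + a) (q + a) (by gcongr) (by gcongr)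

/-- `p ∈ ℤᵏ` is a period of `x`: `x(m + p, n + p) = x(m, n)` whenever `m ≤ n` in `ℕᵏ` and
`m + p ≥ 0`. Here `m'` and `n'` stand for `m + p` and `n + p`. -/
def InfinitePath.HasPeriod {k : ℕ} {Λ : Type*} [Monoid Λ] {d : Λ →* Multiplicative (Fin k → ℕ)}
    (x : InfinitePath d) (p : Fin k → ℤ) : Prop :=
  ∀ (m n m' n' : Fin k → ℕ) (h : m ≤ n) (h' : m' ≤ n'),
    (∀ i, (m' i : ℤ) = m i + p i) → (∀ i, (n' i : ℤ) = n i + p i) →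
      x.seg m' n' h' = x.seg m n h

/-- `x` is neither periodic nor eventually periodic: no shift `σᵃ x` (`a = 0` included) has a
non-zero period. -/
def InfinitePath.IsAperiodic {k : ℕ} {Λ : Type*} [Monoid Λ]
    {d : Λ →* Multiplicative (Fin k → ℕ)} (x : InfinitePath d) : Prop :=
  ∀ (a : Fin k → ℕ) (p : Fin k → ℤ), (x.shift a).HasPeriod p → p = 0

/-- The Kumjian-Pask aperiodicity condition (for a single vertex): there is an aperiodic infinite
path. -/
def IsAperiodic {k : ℕ} {Λ : Type*} [Monoid Λ]
    (d : Λ →* Multiplicative (Fin k → ℕ)) : Prop :=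
  ∃ x : InfinitePath d, x.IsAperiodic

end KGraph

/-- The associated `k`-graph `𝔽_R⁺` is, for every `k ≥ 2`, a `k`-graph and aperiodic. -/
def YBE.IsAperiodic {X : Type*} (R : Equiv.Perm (X × X)) : Prop :=
  ∀ k : ℕ, 2 ≤ k → KGraph.IsSingleVertexKGraph (YBE.assocDegree R k) ∧
    KGraph.IsAperiodic (YBE.assocDegree R k)

/-! Reordering two adjacent colours in a word acts on the letters by `R`, `R⁻¹` or the identity, so
words in any fixed colour order represent every element of the matching degree. They do so uniquely:
by the Yang-Baxter equation the monoid acts on words by insertion, and this action recovers a sorted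
word from its element. Hence the factorization property.

For aperiodicity it suffices that each non-zero `p` is broken by one finite element
(`BreaksPeriod`): there are countably many `p`, and a product in which these elements all recur
arbitrarily late is a path none of whose shifts has a non-zero period.

Such elements exist for non-degenerate `R`, because any two edges of different colours complete to a
commuting square. The positive and negative parts of `p` involve disjoint colours, so one can grow
an element in both directions and make the letters of some colour `i` at positions `p⁻` and `p⁺`
differ.

For the converse, obstructions to periods lift along surjective morphisms, and a degenerate solution
on three points maps onto the flip on two points. -/

namespace YBE

variable {X : Type*} {R : Equiv.Perm (X × X)} {k : ℕ}

/-! ### Words and normal forms -/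

/-- The element of `𝔽_R⁺` represented by a word. -/
def word (R : Equiv.Perm (X × X)) (l : List (Fin k × X)) : AssocMonoid R k :=
  PresentedMonoid.mk (CommRel R k) (FreeMonoid.ofList l)

lemma word_nil : word R ([] : List (Fin k × X)) = 1 := rfl

lemma word_append (l l' : List (Fin k × X)) : word R (l ++ l') = word R l * word R l' := rfl

lemma word_cons (a : Fin k × X) (l : List (Fin k × X)) :
    word R (a :: l) = word R [a] * word R l := rfl

lemma exists_word (x : AssocMonoid R k) : ∃ l, word R l = x := by
  induction x using PresentedMonoid.inductionOn with
  | _ z => exact ⟨FreeMonoid.toList z, rfl⟩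

lemma word_swap {i j : Fin k} (hij : i < j) (s t : X) :
    word R [(i, s), (j, t)] = word R [(j, (R (s, t)).1), (i, (R (s, t)).2)] :=
  PresentedMonoid.mk_eq_mk_of_rel (CommRel.swap i j hij s t _ _ rfl)

lemma degree_word (l : List (Fin k × X)) (i : Fin k) :
    (assocDegree R k (word R l)).toAdd i = (l.map Prod.fst).count i := by
  induction l with
  | nil => rw [word_nil, map_one]; simp
  | cons a l ih =>
    have h : assocDegree R k (word R [a]) = Multiplicative.ofAdd (Pi.single a.1 1) := rfl
    rw [word_cons, map_mul, toAdd_mul, Pi.add_apply, ih, h]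
    rw [List.map_cons, List.count_cons, add_comm]
    congr 1
    by_cases e : i = a.1
    · subst e; simp
    · simp [e, Ne.symm e]

lemma exists_colors (m : Fin k → ℕ) : ∃ c : List (Fin k), ∀ i, c.count i = m i :=
  ⟨(Finsupp.toMultiset (Finsupp.equivFunOnFinite.symm m)).toList, fun i => by
    rw [← Multiset.coe_count, Multiset.coe_toList, Finsupp.count_toMultiset]; rfl⟩

/-- Left multiplication of a word by a letter of colour `c`, which is moved to the right past all
letters of smaller colours. -/
def insertLetter (R : Equiv.Perm (X × X)) (c : Fin k) : X → List (Fin k × X) → List (Fin k × X)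
  | s, [] => [(c, s)]
  | s, (c', t) :: w =>
    if c' < c then (c', (R.symm (s, t)).1) :: insertLetter R c (R.symm (s, t)).2 w
    else (c, s) :: (c', t) :: w

/-- The Yang-Baxter equation in the form needed when two letters both move right past a third. -/
lemma IsSolution.symm_comm (hR : IsSolution R) (s t u : X) :
    leg23 R (leg12 R.symm (leg23 R.symm (s, t, u))) =
      leg12 R.symm (leg23 R.symm (leg12 R (s, t, u))) := by
  have l12 : ∀ x, leg12 R (leg12 R.symm x) = x := fun x => by simp [leg12]
  have l12' : ∀ x, leg12 R.symm (leg12 R x) = x := fun x => by simp [leg12]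
  have l23 : ∀ x, leg23 R (leg23 R.symm x) = x := fun x => by simp [leg23]
  have l23' : ∀ x, leg23 R.symm (leg23 R x) = x := fun x => by simp [leg23]
  have h := congrFun hR (leg12 R.symm (leg23 R.symm (s, t, u)))
  simp only [Function.comp_apply, l12, l23] at h
  rw [h, l23', l12']

/-- Only when both letters pass the head of the word is the Yang-Baxter equation needed. Otherwise
the `i`-letter stops in front, and `R⁻¹` undoes `R` as the `j`-letter crosses it. -/
lemma insertLetter_comm (hR : IsSolution R) {i j : Fin k} (hij : i < j) (w : List (Fin k × X)) :
    ∀ s t : X, insertLetter R i s (insertLetter R j t w) =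
      insertLetter R j (R (s, t)).1 (insertLetter R i (R (s, t)).2 w) := by
  induction w with
  | nil => intro s t; simp [insertLetter, hij, hij.not_gt]
  | cons a w ih =>
    obtain ⟨c, u⟩ := a
    intro s t
    by_cases hi : c < i
    · have h := hR.symm_comm s t u
      simp only [leg12, leg23, Prod.ext_iff] at h
      obtain ⟨h1, h2, h3⟩ := h
      simp only [insertLetter, hi, hi.trans hij, if_true, ih]
      simp only [h1, h2, h3]
    · by_cases hj : c < j
      · simp [insertLetter, hi, hj, hij]
      · simp [insertLetter, hi, hj, hij, hij.not_gt]

/-- The action of `𝔽_R⁺` on words by insertion of letters. -/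
def insertHom (hR : IsSolution R) (k : ℕ) :
    AssocMonoid R k →* Function.End (List (Fin k × X)) :=
  PresentedMonoid.lift (M := Function.End (List (Fin k × X)))
    (fun e => insertLetter R e.1 e.2) (by
    rintro _ _ ⟨i, j, hij, s, t, t', s', h⟩
    funext w
    have := insertLetter_comm hR hij w s t
    rw [h] at this
    exact this)

/-- In a sorted word no inserted letter has to move, so sorted words are normal forms. -/
lemma insertHom_word (hR : IsSolution R) (l : List (Fin k × X))
    (hl : (l.map Prod.fst).Pairwise (· ≤ ·)) : insertHom hR k (word R l) [] = l := by
  induction l with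
  | nil => rfl
  | cons a l ih =>
    rw [List.map_cons, List.pairwise_cons] at hl
    have h : insertHom hR k (word R (a :: l)) [] =
        insertLetter R a.1 a.2 (insertHom hR k (word R l) []) := by
      rw [word_cons, map_mul]; rfl
    rw [h, ih hl.2]
    cases l with
    | nil => rfl
    | cons b l =>
      have : ¬ b.1 < a.1 := not_lt.2 (hl.1 _ (by simp))
      simp [insertLetter, this]

lemma word_singleton_inj (hR : IsSolution R) {i : Fin k} {s t : X}
    (h : word R [(i, s)] = word R [(i, t)]) : s = t := by
  have : insertHom hR k _ [] = insertHom hR k _ [] := congrArg (fun z => insertHom hR k z []) h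
  rw [insertHom_word hR _ (by simp), insertHom_word hR _ (by simp)] at this
  simpa using this

/-! ### Unique factorization -/

/-- The action of a bijection of `List X` on the tail of a list. -/
def tailEquiv (σ : List X ≃ List X) : List X ≃ List X where
  toFun | [] => [] | x :: v => x :: σ v
  invFun | [] => [] | x :: v => x :: σ.symm v
  left_inv v := by cases v <;> simp
  right_inv v := by cases v <;> simp

/-- The action of a bijection of `X²` on the first two letters of a list. -/
def headEquiv (σ : Equiv.Perm (X × X)) : List X ≃ List X where
  toFun | x :: y :: v => (σ (x, y)).1 :: (σ (x, y)).2 :: v | v => v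
  invFun | x :: y :: v => (σ.symm (x, y)).1 :: (σ.symm (x, y)).2 :: v | v => v
  left_inv v := by rcases v with _ | ⟨x, _ | ⟨y, v⟩⟩ <;> simp
  right_inv v := by rcases v with _ | ⟨x, _ | ⟨y, v⟩⟩ <;> simp

lemma exists_equiv_of_perm (R : Equiv.Perm (X × X)) {c c' : List (Fin k)} (h : c.Perm c') :
    ∃ σ : List X ≃ List X, (∀ v, (σ v).length = v.length) ∧
      ∀ v, v.length = c.length → word R (c.zip v) = word R (c'.zip (σ v)) := by
  induction h with
  | nil => exact ⟨Equiv.refl _, fun _ => rfl, fun _ _ => rfl⟩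
  | cons a _ ih =>
    obtain ⟨σ, h1, h2⟩ := ih
    refine ⟨tailEquiv σ, fun v => ?_, fun v hv => ?_⟩
    · cases v <;> simp [tailEquiv, h1]
    · cases v with
      | nil => simp at hv
      | cons x v =>
        simp only [tailEquiv, Equiv.coe_fn_mk, List.zip_cons_cons]
        rw [word_cons, word_cons (_, _) (List.zip _ (σ v)), h2 v (by simpa using hv)]
  | swap a b l =>
    have key : ∃ τ : Equiv.Perm (X × X), ∀ x y, word R [(b, x), (a, y)] =
        word R [(a, (τ (x, y)).1), (b, (τ (x, y)).2)] := by
      rcases lt_trichotomy a b with hab | rfl | hab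
      · refine ⟨R.symm, fun x y => ?_⟩
        rw [word_swap hab]; simp
      · exact ⟨Equiv.refl _, fun _ _ => rfl⟩
      · exact ⟨R, fun x y => word_swap hab x y⟩
    obtain ⟨τ, hτ⟩ := key
    refine ⟨headEquiv τ, fun v => ?_, fun v hv => ?_⟩
    · rcases v with _ | ⟨x, _ | ⟨y, v⟩⟩ <;> simp [headEquiv]
    · rcases v with _ | ⟨x, _ | ⟨y, v⟩⟩
      · simp at hv
      · simp at hv
      · simp only [headEquiv, Equiv.coe_fn_mk, List.zip_cons_cons]
        exact congrArg (· * word R (l.zip v)) (hτ x y)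
  | trans _ _ ih ih' =>
    rename_i hp _
    obtain ⟨σ, h1, h2⟩ := ih
    obtain ⟨τ, h3, h4⟩ := ih'
    refine ⟨σ.trans τ, fun v => by simp [h1, h3], fun v hv => ?_⟩
    rw [h2 v hv, h4 (σ v) (by rw [h1, hv, hp.length_eq])]; rfl

/-- Sorting the colours changes the letters by a bijection, and sorted words can be read off from
their elements. -/
lemma eq_of_word_zip_eq (hR : IsSolution R) (c : List (Fin k)) {v w : List X}
    (hv : v.length = c.length) (hw : w.length = c.length)
    (h : word R (c.zip v) = word R (c.zip w)) : v = w := by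
  have hp : c.Perm (c.mergeSort (· ≤ ·)) := (List.mergeSort_perm _ _).symm
  obtain ⟨σ, h1, h2⟩ := exists_equiv_of_perm R hp
  have key : ∀ v : List X, v.length = c.length →
      insertHom hR k (word R (c.zip v)) [] = (c.mergeSort (· ≤ ·)).zip (σ v) := fun v hv => by
    rw [h2 v hv]
    apply insertHom_word
    rw [List.map_fst_zip (by rw [h1, hv, hp.length_eq])]
    simpa using List.pairwise_mergeSort (le := fun a b : Fin k => decide (a ≤ b))
      (fun a b c => by simpa using le_trans) (fun a b => by simpa using le_total a b) c
  have e := key w hw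
  rw [← h, key v hv] at e
  have e' := congrArg (List.map Prod.snd) e
  rw [List.map_snd_zip (by rw [h1, hv, hp.length_eq]),
    List.map_snd_zip (by rw [h1, hw, hp.length_eq])] at e'
  exact σ.injective e'

lemma exists_word_zip (c : List (Fin k)) (x : AssocMonoid R k)
    (h : ∀ i, (assocDegree R k x).toAdd i = c.count i) :
    ∃ v : List X, v.length = c.length ∧ word R (c.zip v) = x := by
  obtain ⟨l, rfl⟩ := exists_word x
  have hp : (l.map Prod.fst).Perm c := List.perm_iff_count.2 fun i => by rw [← h, degree_word]
  obtain ⟨σ, h1, h2⟩ := exists_equiv_of_perm R hp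
  refine ⟨σ (l.map Prod.snd), by rw [h1, ← hp.length_eq]; simp, ?_⟩
  rw [← h2 _ (by simp)]
  congr 1
  exact (List.zip_of_prod rfl rfl).symm

lemma degree_word_zip (c : List (Fin k)) (v : List X) (hv : v.length = c.length) (i : Fin k) :
    (assocDegree R k (word R (c.zip v))).toAdd i = c.count i := by
  rw [degree_word, List.map_fst_zip hv.ge]

/-- For a YBE solution `R`, the monoid `𝔽_R⁺` is a single-vertex `k`-graph. -/
theorem isSingleVertexKGraph [Countable X] (hR : IsSolution R) (k : ℕ) :
    KGraph.IsSingleVertexKGraph (assocDegree R k) := by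
  constructor
  · have hc : Countable (List (Fin k × X)) := inferInstance
    exact Function.Surjective.countable (f := word R) exists_word
  intro l m n hl
  obtain ⟨c, hc⟩ := exists_colors m
  obtain ⟨c', hc'⟩ := exists_colors n
  obtain ⟨v, hv, rfl⟩ := exists_word_zip (c ++ c') l
    (fun i => by rw [hl, List.count_append, hc, hc']; rfl)
  rw [List.length_append] at hv
  have h1 : (v.take c.length).length = c.length := by simp; omega
  have h2 : (v.drop c.length).length = c'.length := by simp; omega
  refine ⟨(word R (c.zip (v.take c.length)), word R (c'.zip (v.drop c.length))),
    ⟨?_, ?_, ?_⟩, ?_⟩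
  · funext i; rw [degree_word_zip _ _ h1, hc]
  · funext i; rw [degree_word_zip _ _ h2, hc']
  · rw [← word_append, ← List.zip_append h1.symm, List.take_append_drop]
  · rintro ⟨a, b⟩ ⟨ha, hb, hab⟩
    obtain ⟨u, hu, rfl⟩ := exists_word_zip c a (fun i => by rw [hc, ← ha])
    obtain ⟨u', hu', rfl⟩ := exists_word_zip c' b (fun i => by rw [hc', ← hb])
    rw [← word_append, ← List.zip_append hu.symm] at hab
    have := eq_of_word_zip_eq hR _ (by simpa using hv) (by simp [hu, hu']) hab
    subst this
    simp [← hu]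

end YBE

/-! ### Aperiodicity from finite obstructions to periods -/

namespace KGraph

variable {k : ℕ} {Λ : Type*} [Monoid Λ] {d : Λ →* Multiplicative (Fin k → ℕ)}

/-- Some element of `Λ` has different segments of the same degree at two positions that differ
by `p`. -/
def BreaksPeriod (d : Λ →* Multiplicative (Fin k → ℕ)) (p : Fin k → ℤ) : Prop :=
  ∃ a b c a' b' c' : Λ, a * b * c = a' * b' * c' ∧ d b = d b' ∧ b ≠ b' ∧
    ∀ i, ((d a').toAdd i : ℤ) = (d a).toAdd i + p i

lemma BreaksPeriod.neg {p : Fin k → ℤ} (h : BreaksPeriod d (-p)) : BreaksPeriod d p := by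
  obtain ⟨a, b, c, a', b', c', h1, h2, h3, h4⟩ := h
  refine ⟨a', b', c', a, b, c, h1.symm, h2.symm, h3.symm, fun i => ?_⟩
  have := h4 i
  simp only [Pi.neg_apply] at this
  omega

lemma IsSingleVertexKGraph.mul_inj (hd : IsSingleVertexKGraph d) {a b a' b' : Λ}
    (h : a * b = a' * b') (ha : d a = d a') : a = a' ∧ b = b' := by
  have hb : d b = d b' := by
    have := congrArg d h
    rw [map_mul, map_mul, ha] at this
    exact mul_left_cancel this
  have := (hd.2 (a * b) (d a).toAdd (d b).toAdd (by simp)).unique (y₁ := (a, b)) (y₂ := (a', b'))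
    ⟨rfl, rfl, rfl⟩ ⟨by simp [ha], by simp [hb], h⟩
  simpa using this

lemma IsSingleVertexKGraph.exists_mul (hd : IsSingleVertexKGraph d) (l : Λ) (m : Fin k → ℕ)
    (h : m ≤ (d l).toAdd) : ∃ a b, l = a * b ∧ (d a).toAdd = m := by
  obtain ⟨⟨a, b⟩, h, -⟩ := hd.2 l m ((d l).toAdd - m) (by rw [add_tsub_cancel_of_le h])
  exact ⟨a, b, h.2.2, h.1⟩

/-- `b` is the segment from `m` to `n` of some member of the sequence `P`. -/
def IsSegment (d : Λ →* Multiplicative (Fin k → ℕ)) (P : ℕ → Λ) (m n : Fin k → ℕ) (b : Λ) : Prop :=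
  ∃ N a c, P N = a * b * c ∧ (d a).toAdd = m ∧ m + (d b).toAdd = n

section

variable {P : ℕ → Λ}

/-- Both factorizations extend to a common later member of `P`, where unique factorization applies.
-/
lemma IsSegment.eq (hd : IsSingleVertexKGraph d) (hP : ∀ M N, M ≤ N → ∃ e, P N = P M * e)
    {m n : Fin k → ℕ} {b b' : Λ} (h : IsSegment d P m n b) (h' : IsSegment d P m n b') :
    b = b' := by
  obtain ⟨N, a, c, h1, h2, h3⟩ := h
  obtain ⟨N', a', c', h1', h2', h3'⟩ := h'
  obtain ⟨e, he⟩ := hP N (max N N') (le_max_left _ _)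
  obtain ⟨e', he'⟩ := hP N' (max N N') (le_max_right _ _)
  have key : a * (b * (c * e)) = a' * (b' * (c' * e')) := by
    rw [h1] at he; rw [h1'] at he'
    simp only [mul_assoc] at he he'
    rw [← he, ← he']
  have := (hd.mul_inj key (Multiplicative.toAdd.injective (h2.trans h2'.symm))).2
  exact (hd.mul_inj this (Multiplicative.toAdd.injective
    (add_left_cancel (h3.trans h3'.symm)))).1

lemma exists_isSegment (hd : IsSingleVertexKGraph d)
    (hcof : ∀ n : Fin k → ℕ, ∃ N, n ≤ (d (P N)).toAdd) {m n q : Fin k → ℕ} (h : m ≤ n)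
    (h' : n ≤ q) :
    ∃ b b', IsSegment d P m n b ∧ IsSegment d P n q b' ∧ IsSegment d P m q (b * b') := by
  obtain ⟨N, hN⟩ := hcof q
  obtain ⟨a, e, h1, h2⟩ := hd.exists_mul (P N) m (h.trans (h'.trans hN))
  have hde : m + (d e).toAdd = (d (P N)).toAdd := by rw [h1, map_mul, toAdd_mul, h2]
  obtain ⟨b, e', rfl, h4⟩ := hd.exists_mul e (n - m) (by
    intro i; have := congrFun hde i; have := hN i; have := h' i; have := h i
    simp only [Pi.add_apply, Pi.sub_apply] at *; omega)
  rw [map_mul, toAdd_mul, h4, ← add_assoc, add_tsub_cancel_of_le h] at hde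
  obtain ⟨b', c, rfl, h6⟩ := hd.exists_mul e' (q - n) (by
    intro i; have := congrFun hde i; have := hN i; have := h' i
    simp only [Pi.add_apply, Pi.sub_apply] at *; omega)
  refine ⟨b, b', ⟨N, a, b' * c, by rw [h1, mul_assoc], h2, by rw [h4, add_tsub_cancel_of_le h]⟩,
    ⟨N, a * b, c, by rw [h1]; simp only [mul_assoc], ?_, by rw [h6, add_tsub_cancel_of_le h']⟩,
    ⟨N, a, c, by rw [h1]; simp only [mul_assoc], h2, ?_⟩⟩
  · rw [map_mul, toAdd_mul, h2, h4, add_tsub_cancel_of_le h]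
  · rw [map_mul, toAdd_mul, h4, h6, ← add_assoc, add_tsub_cancel_of_le h,
      add_tsub_cancel_of_le h']

/-- A sequence of elements of unbounded degree, each of which extends the previous ones, has
a limit path. -/
lemma exists_infinitePath (hd : IsSingleVertexKGraph d)
    (hP : ∀ M N, M ≤ N → ∃ e, P N = P M * e)
    (hcof : ∀ n : Fin k → ℕ, ∃ N, n ≤ (d (P N)).toAdd) :
    ∃ x : InfinitePath d, ∀ m n h b, IsSegment d P m n b → x.seg m n h = b := by
  have hex : ∀ m n : Fin k → ℕ, m ≤ n → ∃ b, IsSegment d P m n b := fun m n h => by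
    obtain ⟨b, _, hb, _⟩ := exists_isSegment hd hcof h le_rfl
    exact ⟨b, hb⟩
  choose f hf using hex
  refine ⟨⟨f, fun m n h => ?_, fun m => ?_, fun m n q h h' => ?_⟩,
    fun m n h b hb => (hf m n h).eq hd hP hb⟩
  · obtain ⟨_, _, _, _, _, h3⟩ := hf m n h
    exact h3
  · obtain ⟨N, a, c, h1, h2, h3⟩ := hf m m le_rfl
    refine (hf m m le_rfl).eq hd hP ⟨N, a, f m m le_rfl * c, ?_, h2, by simp⟩
    rw [h1, mul_one, mul_assoc]
  · obtain ⟨b, b', h1, h2, h3⟩ := exists_isSegment hd hcof h h'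
    rw [(hf m n h).eq hd hP h1, (hf n q h').eq hd hP h2, (hf m q _).eq hd hP h3]

end

/-- If every non-zero `p` is broken by some element of `Λ`, then the product of a sequence in
which all these elements occur infinitely often is an aperiodic path. -/
theorem isAperiodic_of_breaksPeriod (hd : IsSingleVertexKGraph d)
    (hu : ∃ u : Λ, (d u).toAdd = 1) (h : ∀ p : Fin k → ℤ, p ≠ 0 → BreaksPeriod d p) :
    IsAperiodic d := by
  obtain ⟨u, hu⟩ := hu
  have h' : ∀ p : Fin k → ℤ, ∃ l : Λ, p ≠ 0 → ∃ a b c a' b' c' : Λ, l = a * b * c ∧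
      l = a' * b' * c' ∧ d b = d b' ∧ b ≠ b' ∧
      ∀ i, ((d a').toAdd i : ℤ) = (d a).toAdd i + p i := fun p => by
    by_cases hp : p = 0
    · exact ⟨1, fun h => (h hp).elim⟩
    · obtain ⟨a, b, c, a', b', c', h1, h2⟩ := h p hp
      exact ⟨a * b * c, fun _ => ⟨a, b, c, a', b', c', rfl, h1, h2⟩⟩
  choose L hL using h'
  obtain ⟨q, hq⟩ := exists_surjective_nat (Fin k → ℤ)
  -- Unpairing makes every `p` recur at arbitrarily late stages; the factor `u` makes the degree
  -- grow in every colour.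
  let P : ℕ → Λ := fun n => Nat.rec 1 (fun n z => z * (L (q n.unpair.1) * u)) n
  have P_succ : ∀ n, P (n + 1) = P n * (L (q n.unpair.1) * u) := fun n => rfl
  have hP : ∀ M N, M ≤ N → ∃ e, P N = P M * e := fun M N hMN => by
    induction hMN with
    | refl => exact ⟨1, (mul_one _).symm⟩
    | step _ ih =>
      obtain ⟨e, he⟩ := ih
      exact ⟨_, by rw [P_succ, he, mul_assoc]⟩
  have hdeg : ∀ N i, N ≤ (d (P N)).toAdd i := fun N i => by
    induction N with
    | zero => exact Nat.zero_le _
    | succ N ih =>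
      rw [P_succ, map_mul, map_mul d, toAdd_mul, toAdd_mul, hu]
      simp only [Pi.add_apply, Pi.one_apply]
      omega
  have hle : ∀ n : Fin k → ℕ, ∀ i, n i ≤ ∑ j, n j := fun n i =>
    Finset.single_le_sum (fun _ _ => Nat.zero_le _) (Finset.mem_univ i)
  obtain ⟨x, hx⟩ := exists_infinitePath hd hP
    (fun n => ⟨∑ j, n j, fun i => (hle n i).trans (hdeg _ i)⟩)
  refine ⟨x, fun m p hper => ?_⟩
  by_contra hp
  obtain ⟨e, rfl⟩ := hq p
  obtain ⟨a, b, c, a', b', c', h1, h2, h3, h4, h5⟩ := hL _ hp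
  -- A stage that treats `q e` and begins beyond the shift `m`, since `P N` has degree at least `N`
  -- in each colour.
  let N := Nat.pair e (∑ j, m j)
  have hN : P (N + 1) = P N * (L (q e) * u) := by rw [P_succ, Nat.unpair_pair]
  have hm : m ≤ (d (P N)).toAdd := fun i =>
    (hle m i).trans ((Nat.right_le_pair _ _).trans (hdeg N i))
  have hseg : ∀ a b c, L (q e) = a * b * c → ∀ h,
      x.seg ((d (P N)).toAdd - m + (d a).toAdd + m)
        ((d (P N)).toAdd - m + (d a).toAdd + (d b).toAdd + m) h = b := fun a b c habc h => by
    refine hx _ _ _ _ ⟨N + 1, P N * a, c * u, by rw [hN, habc]; simp only [mul_assoc], ?_, ?_⟩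
    · rw [map_mul, toAdd_mul, add_right_comm, tsub_add_cancel_of_le hm]
    · rw [add_right_comm]
  have key := hper ((d (P N)).toAdd - m + (d a).toAdd)
    ((d (P N)).toAdd - m + (d a).toAdd + (d b).toAdd)
    ((d (P N)).toAdd - m + (d a').toAdd)
    ((d (P N)).toAdd - m + (d a').toAdd + (d b').toAdd)
    (le_self_add) (le_self_add)
    (fun i => by simp only [Pi.add_apply, Nat.cast_add, h5]; ring)
    (fun i => by simp only [Pi.add_apply, Nat.cast_add, h5, h3]; ring)
  simp only [InfinitePath.shift] at key
  rw [hseg a b c h1, hseg a' b' c' h2] at key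
  exact h4 key.symm

/-- Obstructions to periods lift along a surjective morphism of `k`-graphs. -/
lemma BreaksPeriod.lift {Λ' : Type*} [Monoid Λ'] {d' : Λ' →* Multiplicative (Fin k → ℕ)}
    (hd : IsSingleVertexKGraph d) (hd' : IsSingleVertexKGraph d') (f : Λ' →* Λ)
    (hf : Function.Surjective f) (hfd : ∀ z, d (f z) = d' z) {p : Fin k → ℤ}
    (h : BreaksPeriod d p) : BreaksPeriod d' p := by
  obtain ⟨a, b, c, a', b', c', h1, h2, h3, h4⟩ := h
  obtain ⟨l, hl⟩ := hf (a * b * c)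
  -- Factor `l` by the degrees of `a`, `b`, `c`; uniqueness downstairs forces the images to be `a`
  -- and `b`.
  have key : ∀ a b c, f l = a * b * c → ∃ A B C, l = A * B * C ∧ f A = a ∧ f B = b := by
    intro a b c hl
    have hl' : (d' l).toAdd = (d a).toAdd + (d b).toAdd + (d c).toAdd := by
      rw [← hfd, hl, map_mul, map_mul d]; rfl
    obtain ⟨A, E, rfl, hA⟩ := hd'.exists_mul l (d a).toAdd (by
      rw [hl', add_assoc]; exact le_self_add)
    rw [map_mul, toAdd_mul, hA, add_assoc] at hl'
    obtain ⟨B, C, rfl, hB⟩ := hd'.exists_mul E (d b).toAdd (by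
      rw [add_left_cancel hl']; exact le_self_add)
    simp only [map_mul, mul_assoc] at hl
    obtain ⟨e1, e2⟩ := hd.mul_inj hl (by rw [hfd]; exact Multiplicative.toAdd.injective hA)
    obtain ⟨e3, -⟩ := hd.mul_inj e2 (by rw [hfd]; exact Multiplicative.toAdd.injective hB)
    exact ⟨A, B, C, by rw [mul_assoc], e1, e3⟩
  obtain ⟨A, B, C, e1, rfl, rfl⟩ := key a b c hl
  obtain ⟨A', B', C', e1', rfl, rfl⟩ := key a' b' c' (hl.trans h1)
  refine ⟨A, B, C, A', B', C', e1.symm.trans e1', by rw [← hfd, h2, hfd],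
    fun h => h3 (by rw [h]), fun i => by rw [← hfd, ← hfd, h4]⟩

end KGraph

/-! ### Non-degenerate solutions -/

namespace YBE

variable {X : Type*} {R : Equiv.Perm (X × X)} {k : ℕ}

lemma exists_degree_one [Nonempty X] : ∃ u : AssocMonoid R k, (assocDegree R k u).toAdd = 1 := by
  obtain ⟨c, hc⟩ := exists_colors (1 : Fin k → ℕ)
  obtain ⟨s⟩ := ‹Nonempty X›
  refine ⟨word R (c.map (·, s)), funext fun i => ?_⟩
  rw [degree_word, ← hc, List.map_map]
  exact congrArg (List.count i) (List.map_id' c)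

lemma IsNondegenerate.exists_square (hR : IsNondegenerate R) {i j : Fin k} (hij : i ≠ j)
    (s t : X) : ∃ s' t', word R [(i, s), (j, t')] = word R [(j, t), (i, s')] := by
  rcases lt_or_gt_of_ne hij with h | h
  · obtain ⟨t', ht'⟩ := (hR.2 s).2 t
    exact ⟨_, t', by rw [word_swap h]; simp only at ht'; rw [ht']⟩
  · obtain ⟨s', hs'⟩ := (hR.2 t).2 s
    exact ⟨s', _, by rw [word_swap h]; simp only at hs'; rw [hs']⟩

/-- Squares are glued along `l`, carrying the `i`-letter from one end to the other. -/
lemma IsNondegenerate.exists_strip (hR : IsNondegenerate R) (i : Fin k) (l : List (Fin k × X)) :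
    ∀ (s : X), (∀ b ∈ l, i ≠ b.1) → ∃ s' l', l'.map Prod.fst = l.map Prod.fst ∧
      word R [(i, s)] * word R l' = word R l * word R [(i, s')] := by
  induction l with
  | nil => exact fun s _ => ⟨s, [], rfl, by simp [word_nil]⟩
  | cons b l ih =>
    intro s h
    obtain ⟨j, t⟩ := b
    obtain ⟨s', t', h1⟩ := hR.exists_square (h (j, t) (by simp)) s t
    obtain ⟨s'', l', h2, h3⟩ := ih s' (fun b hb => h b (by simp [hb]))
    refine ⟨s'', (j, t') :: l', by simp [h2], ?_⟩
    rw [word_cons (j, t) l, mul_assoc, ← h3, word_cons (j, t') l', ← mul_assoc, ← mul_assoc]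
    exact congrArg (· * word R l') h1

/-- Words with disjoint sets of colours have a common right multiple. -/
lemma IsNondegenerate.exists_rectangle (hR : IsNondegenerate R) (l₁ : List (Fin k × X)) :
    ∀ l₂ : List (Fin k × X), (∀ a ∈ l₁, ∀ b ∈ l₂, a.1 ≠ b.1) → ∃ z z',
      word R l₁ * z = word R l₂ * z' := by
  induction l₁ with
  | nil => exact fun l₂ _ => ⟨word R l₂, 1, by simp [word_nil]⟩
  | cons a l₁ ih =>
    intro l₂ h
    obtain ⟨i, s⟩ := a
    obtain ⟨s', l', h1, h2⟩ := hR.exists_strip i l₂ s (h (i, s) (by simp))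
    obtain ⟨z, z', h3⟩ := ih l' (fun a ha b hb => by
      have hb' : b.1 ∈ l₂.map Prod.fst := h1 ▸ List.mem_map_of_mem hb
      obtain ⟨b', hb', e⟩ := List.mem_map.1 hb'
      exact e ▸ h a (by simp [ha]) b' hb')
    exact ⟨z, word R [(i, s')] * z', by
      rw [word_cons, mul_assoc, h3, ← mul_assoc, h2, mul_assoc]⟩

lemma IsNondegenerate.breaksPeriod [Nontrivial X] (hS : IsSolution R) (hR : IsNondegenerate R)
    {p : Fin k → ℤ} (hp : p ≠ 0) : KGraph.BreaksPeriod (assocDegree R k) p := by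
  wlog hpos : ∃ i, 0 < p i generalizing p
  · refine (this (neg_ne_zero.2 hp) ?_).neg
    obtain ⟨i, hi⟩ := Function.ne_iff.1 hp
    push Not at hpos
    exact ⟨i, by have := hpos i; simp only [Pi.neg_apply, Pi.zero_apply] at *; omega⟩
  obtain ⟨i, hi⟩ := hpos
  obtain ⟨s⟩ : Nonempty X := inferInstance
  -- One letter of colour `i` is left out of `p⁺`: the initial `(i, s)` supplies it.
  obtain ⟨c, hc⟩ := exists_colors (fun j => (p j).toNat - if j = i then 1 else 0)
  obtain ⟨c', hc'⟩ := exists_colors (fun j => (-p j).toNat)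
  have hmem : ∀ j ∈ c', p j < 0 := fun j hj => by
    have := List.count_pos_iff.2 hj; rw [hc'] at this; omega
  have hmem' : ∀ j ∈ c, 0 < p j := fun j hj => by
    have := List.count_pos_iff.2 hj; rw [hc] at this; omega
  have hfst : ∀ c : List (Fin k), (c.map (·, s)).map Prod.fst = c := fun c => by
    rw [List.map_map]; exact List.map_id' c
  obtain ⟨g, l', h1, h2⟩ := hR.exists_strip i (c'.map (·, s)) s (fun b hb => by
    obtain ⟨j, hj, rfl⟩ := List.mem_map.1 hb
    have := hmem j hj
    rintro rfl; exact lt_asymm this hi)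
  rw [hfst] at h1
  -- The strip forces the `i`-letter `g` at position `p⁻`, while the `i`-letter at `p⁺` is still
  -- free.
  obtain ⟨f, hf⟩ := exists_ne g
  obtain ⟨z, z', h3⟩ := hR.exists_rectangle l' (c.map (·, s) ++ [(i, f)]) (fun a ha b hb => by
    have ha' := hmem a.1 (h1 ▸ List.mem_map_of_mem ha)
    have hb' : 0 < p b.1 := by
      rcases List.mem_append.1 hb with hb | hb
      · obtain ⟨j, hj, rfl⟩ := List.mem_map.1 hb
        exact hmem' j hj
      · rw [List.mem_singleton] at hb; rw [hb]; exact hi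
    intro e; rw [e] at ha'; omega)
  refine ⟨word R (c'.map (·, s)), word R [(i, g)], z,
    word R ((i, s) :: c.map (·, s)), word R [(i, f)], z', ?_, ?_, ?_, ?_⟩
  · rw [← h2, mul_assoc, h3, word_append, word_cons (i, s) (c.map _)]
    simp only [mul_assoc]
  · rfl
  · exact fun e => hf (word_singleton_inj hS e).symm
  · intro j
    rw [degree_word, degree_word, List.map_cons, hfst, hfst, List.count_cons, hc, hc']
    by_cases hj : j = i
    · subst hj; simp; omega
    · simp [hj, Ne.symm hj]; omega

/-- Non-degenerate solutions of the Yang-Baxter equation are aperiodic. -/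
theorem IsNondegenerate.isAperiodic [Countable X] [Nontrivial X] (hS : IsSolution R)
    (hR : IsNondegenerate R) : IsAperiodic R := fun k _ =>
  ⟨isSingleVertexKGraph hS k, KGraph.isAperiodic_of_breaksPeriod (isSingleVertexKGraph hS k)
    exists_degree_one fun _ hp => hR.breaksPeriod hS hp⟩

/-! ### Morphisms of solutions and a degenerate aperiodic solution -/

/-- The morphism `𝔽_R⁺ → 𝔽_S⁺` induced by a morphism of solutions. -/
def mapHom {Y : Type*} {S : Equiv.Perm (Y × Y)} (f : X → Y)
    (hf : ∀ x y, S (f x, f y) = Prod.map f f (R (x, y))) (k : ℕ) :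
    AssocMonoid R k →* AssocMonoid S k :=
  PresentedMonoid.lift (fun e : Fin k × X => PresentedMonoid.of (CommRel S k) (e.1, f e.2)) (by
    rintro _ _ ⟨i, j, hij, s, t, t', s', h⟩
    have := word_swap (R := S) hij (f s) (f t)
    rw [hf, h] at this
    exact this)

lemma mapHom_word {Y : Type*} {S : Equiv.Perm (Y × Y)} (f : X → Y)
    (hf : ∀ x y, S (f x, f y) = Prod.map f f (R (x, y))) (l : List (Fin k × X)) :
    mapHom f hf k (word R l) = word S (l.map (Prod.map id f)) := by
  induction l with
  | nil => rfl
  | cons a l ih => rw [word_cons, map_mul, ih]; rfl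

/-- A solution is aperiodic if it maps onto a non-degenerate solution. -/
theorem isAperiodic_of_surjective {Y : Type*} [Countable X] [Countable Y] [Nontrivial Y]
    {S : Equiv.Perm (Y × Y)} (hR : IsSolution R) (hS : IsSolution S) (hS' : IsNondegenerate S)
    (f : X → Y) (hf : ∀ x y, S (f x, f y) = Prod.map f f (R (x, y)))
    (hsurj : Function.Surjective f) : IsAperiodic R := fun k _ => by
  have : Nonempty X := ⟨(hsurj (Classical.arbitrary Y)).choose⟩
  refine ⟨isSingleVertexKGraph hR k, KGraph.isAperiodic_of_breaksPeriod (isSingleVertexKGraph hR k)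
    exists_degree_one fun p hp => (hS'.breaksPeriod hS hp).lift (isSingleVertexKGraph hS k)
      (isSingleVertexKGraph hR k) (mapHom f hf k) (fun z => ?_) (fun z => ?_)⟩
  · obtain ⟨l, rfl⟩ := exists_word z
    obtain ⟨l', rfl⟩ := (List.map_surjective_iff.2
      (Function.surjective_id.prodMap hsurj)) l
    exact ⟨word R l', mapHom_word f hf l'⟩
  · obtain ⟨l, rfl⟩ := exists_word z
    rw [mapHom_word]
    refine Multiplicative.toAdd.injective (funext fun i => ?_)
    rw [degree_word, degree_word, List.map_map]
    rfl

/-- The solution on `{0, 1, 2}` that is the identity on `{0, 1}²` and the flip elsewhere. -/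
def partialFlip : Equiv.Perm (Fin 3 × Fin 3) :=
  Function.Involutive.toPerm (fun z => if z.1 < 2 ∧ z.2 < 2 then z else z.swap)
    (by unfold Function.Involutive; decide)

lemma isSolution_partialFlip : IsSolution partialFlip := by
  funext t
  revert t
  decide

lemma not_isNondegenerate_partialFlip : ¬ IsNondegenerate partialFlip := fun h =>
  absurd ((h.2 0).1 (show (partialFlip (0, 0)).1 = (partialFlip (0, 1)).1 by decide)) (by decide)

lemma isAperiodic_partialFlip : IsAperiodic partialFlip := by
  refine isAperiodic_of_surjective (Y := Fin 2) (S := Equiv.prodComm _ _) isSolution_partialFlip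
    (funext fun _ => rfl) ⟨fun _ => Function.bijective_id, fun _ => Function.bijective_id⟩
    -- Collapsing `{0, 1}` to a point turns the identity on its square into the flip of a diagonal
    -- point.
    (fun x => if x < 2 then 0 else 1) (by decide) (by decide)

end YBE

theorem corollary4p9 :
    (∀ (X : Type*) [Finite X] [Nontrivial X] (R : Equiv.Perm (X × X)),
      YBE.IsSolution R → YBE.IsNondegenerate R → YBE.IsAperiodic R) ∧
    (∃ (N : ℕ) (R : Equiv.Perm (Fin N × Fin N)),
      2 ≤ N ∧ YBE.IsSolution R ∧ YBE.IsAperiodic R ∧ ¬ YBE.IsNondegenerate R) :=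
  ⟨fun _ _ _ _ hS hR => hR.isAperiodic hS, 3, YBE.partialFlip, by norm_num,
    YBE.isSolution_partialFlip, YBE.isAperiodic_partialFlip, YBE.not_isNondegenerate_partialFlip⟩
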